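/- Let $\mathcal B\subseteq(\mathbb R^{m}\times\mathbb R^{p})^{\mathbb N_0}$ be a discrete-time linear, time-invariant, complete system (i.e. $\mathcal B$ is a linear subspace, $\sigma\mathcal B\subseteq\mathcal B$ for the shift $(\sigma w)(t)=w(t+1)$, and $\mathcal B$ is closed under pointwise convergence) with trajectories $w=(u,y)$, where $u$ consists of the $m=m(\mathcal B)$ inputs and $y$ of the $p=p(\mathcal B)$ outputs. That $u$ is the input means: after every past of a trajectory every future of $u$ can occur, and $m$ is the maximal number of linear components of $w$ that are free in this sense. Then $\mathcal B$ has state space representations $x(t+1)=Ax(t)+Bu(t)$, $y(t)=Cx(t)+Du(t)$. Let $n=n(\mathcal B)$ be the minimal dimension of the state in such a representation and let the lag $l=l(\mathcal B)$ be the least $K\ge 0$ for which the matrix with block rows $C,CA,\dots,CA^{K-1}$ of a minimal representation has rank $n$. Assume that $\mathcal B$ is controllable: for all $T_0\ge 1$ and all $w_p,w_f\in\mathcal B$ there are $\tilde T\ge 1$ and $v\in\mathcal B$ with $v(t)=w_p(t)$ for $t\le T_0$ and $v(t)=w_f(t-T_0-\tilde T)$ for $t\ge T_0+\tilde T$. Let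 $L\ge l+n+1$ and let $(u_d,y_d)$ be the restriction to $[0,T]$ of a trajectory of $\mathcal B$ such that $u_d$ is persistently exciting of order $L+n$; here $\mathcal H_K(f)$ denotes the Hankel matrix with $K\le T+1$ block rows and columns $(f(s),\dots,f(s+K-1))$, $0\le s\le T-K+1$, and $u_d$ is persistently exciting of order $K$ if $\operatorname{rk}\mathcal H_K(u_d)=Km$. For $1\le i\le p$, $1\le j\le m$ let $\mathcal B^{i,j}$ be the induced single-input single-output system of all pairs $(u_j,y_i)$ with $(u,y)\in\mathcal B$ and $u_k=0$ for $k\ne j$, and let $r_{ij}\in\mathbb N_0\cup\{\infty\}$ be its relative degree, i.e. the index of the first nonzero member of the impulse response $D,CB,CAB,CA^2B,\dots$ of any of its state space representations ($\infty$ if there is none). Put $r_i=\min_{1\le j\le m}r_{ij}$ (with $\min\emptyset=\infty$) and $r=(r_1,\dots,r_p)$. Then the following holds. (a) For every $1\le j\le m$ there is exactly one vector $z^{(j)}=(z^{(j)}_0,\dots,z^{(j)}_{L-l-1})$ with blocks $z^{(j)}_k\in\mathbb R^p$ such that for some $g$ $$\begin{bmatrix}\mathcal H_L(u_d)\\ \mathcal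 H_L(y_d)\end{bmatrix}g=\begin{pmatrix}0_{ml}\\ e_j\\ 0_{m(L-l-1)}\\ 0_{pl}\\ z^{(j)}\end{pmatrix},$$ where $e_j$ is the $j$th unit vector of $\mathbb R^m$. (b) $r_i$ is finite for every $i$ for which the output $y_i$ does not vanish identically on $\mathcal B$, and every finite $r_i$ satisfies $r_i\le L-l-1$. (c) Let $a_{ij}=\big(z^{(j)}_{r_i}\big)_i$ if $r_i<\infty$ and $a_{ij}=0$ if $r_i=\infty$. Then all $r_i$ are finite and $r$ is the vector relative degree of $\mathcal B$ if, and only if, the $p\times m$ matrix $(a_{ij})$ has rank $p$. Here $r\in\mathbb N_0^p$ is the vector relative degree of $\mathcal B$ if, for a state space representation $(A,B,C,D)$ of $\mathcal B$, one has $C_iA^kB=0$ for all $0\le k\le r_i-2$ and $D_i=0$ whenever $r_i>0$, and the decoupling matrix $G$, whose $i$th row is $D_i$ if $r_i=0$ and $C_iA^{r_i-1}B$ if $r_i>0$, has rank $p$ (the subscript $i$ denotes the $i$th row). (d) If all $r_i$ are finite, then $(a_{ij})$ equals the matrix $G$ formed with $r$ from any state space representation of $\mathcal B$; in particular, it is the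 decoupling matrix of $\mathcal B$ if it has rank $p$. -/

import Mathlib

namespace LTI

/-! ### Behaviors

A behavior with signal space `W` is a set of trajectories `ℕ → W` (time axis `0, 1, 2, …`).
Trajectories with `m` inputs and `p` outputs take values in `(Fin m → ℝ) × (Fin p → ℝ)`. -/

/-- The signal space `ℝ^m × ℝ^p`; a signal value is a pair `(u, y)`. -/
abbrev Signal (m p : ℕ) : Type := (Fin m → ℝ) × (Fin p → ℝ)

/-- Linear, time-invariant and complete behaviors: `B` is a vector space, is mapped into itself by
the backward shift, and is closed in the topology of pointwise convergence. -/
structure IsLinearTimeInvariantComplete {m p : ℕ} (B : Set (ℕ → Signal m p)) : Prop where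
  linear : ∃ V : Submodule ℝ (ℕ → Signal m p), (V : Set (ℕ → Signal m p)) = B
  shift : ∀ w ∈ B, (fun t => w (t + 1)) ∈ B
  complete : IsClosed B

/-- The `d` linear components `π w` of the signal `w` are free in `B`: they are not restricted by
the past, i.e. after any past of a trajectory of `B`, every future of `π w` can occur. -/
def IsFree {m p d : ℕ} (B : Set (ℕ → Signal m p)) (π : Signal m p →ₗ[ℝ] (Fin d → ℝ)) : Prop :=
  ∀ w ∈ B, ∀ (T : ℕ) (f : ℕ → Fin d → ℝ),
    ∃ w' ∈ B, (∀ t < T, w' t = w t) ∧ ∀ t, T ≤ t → π (w' t) = f t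

/-- The input cardinality of a behavior: the maximal number of free linear components. -/
noncomputable def inputCard {m p : ℕ} (B : Set (ℕ → Signal m p)) : ℕ :=
  sSup {d : ℕ | ∃ π : Signal m p →ₗ[ℝ] (Fin d → ℝ), IsFree B π}

/-- `B` is a linear, time-invariant, complete system for which `w = (u, y)` is a partition into
`m` inputs `u` and `p` outputs `y`: `u` is free, and `m` is the input cardinality of `B`. -/
structure IsSystem {m p : ℕ} (B : Set (ℕ → Signal m p)) : Prop
    extends IsLinearTimeInvariantComplete B where
  input_free : IsFree B (LinearMap.fst ℝ (Fin m → ℝ) (Fin p → ℝ))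
  input_card : inputCard B = m

/-- Behavioral controllability: every finite past `w_p` on `[0, T]` and every future `w_f` can be
joined by a trajectory of `B` after some time distance `T'`. -/
def Controllable {m p : ℕ} (B : Set (ℕ → Signal m p)) : Prop :=
  ∀ T : ℕ, 1 ≤ T → ∀ wp ∈ B, ∀ wf ∈ B, ∃ T' : ℕ, 1 ≤ T' ∧
    ∃ v ∈ B, (∀ t ≤ T, v t = wp t) ∧ ∀ t, T + T' ≤ t → v t = wf (t - T - T')

/-! ### State space representations -/

/-- Matrices of `x(t+1) = A x(t) + B u(t)`, `y(t) = C x(t) + D u(t)`. -/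
structure StateSpace (n m p : ℕ) where
  A : Matrix (Fin n) (Fin n) ℝ
  B : Matrix (Fin n) (Fin m) ℝ
  C : Matrix (Fin p) (Fin n) ℝ
  D : Matrix (Fin p) (Fin m) ℝ

namespace StateSpace

variable {n m p : ℕ}

/-- The behavior of all input/output trajectories admitting a state trajectory. -/
def behavior (S : StateSpace n m p) : Set (ℕ → Signal m p) :=
  {w | ∃ x : ℕ → Fin n → ℝ, ∀ t,
    x (t + 1) = S.A.mulVec (x t) + S.B.mulVec (w t).1 ∧
    (w t).2 = S.C.mulVec (x t) + S.D.mulVec (w t).1}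

/-- The impulse response `D, CB, CAB, CA²B, …`. -/
def impulseResponse (S : StateSpace n m p) : ℕ → Matrix (Fin p) (Fin m) ℝ
  | 0 => S.D
  | k + 1 => S.C * S.A ^ k * S.B

/-- The truncated observability matrix with the `K` block rows `C, CA, …, CA^(K-1)`. -/
def observabilityMatrix (S : StateSpace n m p) (K : ℕ) : Matrix (Fin K × Fin p) (Fin n) ℝ :=
  Matrix.of fun ki => (S.C * S.A ^ (ki.1 : ℕ)) ki.2

/-- The relative degree in `ℕ ∪ {∞}` of a single-input single-output representation: `0` if
`D ≠ 0`, otherwise the least `r ≥ 1` with `C A^(r-1) B ≠ 0`, and `∞` if there is none. -/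
noncomputable def relDegree (S : StateSpace n 1 1) : ℕ∞ :=
  ⨅ (k : ℕ) (_ : S.impulseResponse k ≠ 0), (k : ℕ∞)

/-- The matrix with rows `D_j` if `r_j = 0` and `C_j A^(r_j - 1) B` if `r_j > 0`. -/
def decouplingMatrix (S : StateSpace n m p) (r : Fin p → ℕ) : Matrix (Fin p) (Fin m) ℝ :=
  Matrix.of fun j => if r j = 0 then S.D j else (S.C * S.A ^ (r j - 1) * S.B) j

/-- The two conditions for `r` to be the vector relative degree of a representation. -/
def HasVectorRelDegree (S : StateSpace n m p) (r : Fin p → ℕ) : Prop :=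
  (∀ j, (∀ k : ℕ, k + 2 ≤ r j → (S.C * S.A ^ k * S.B) j = 0) ∧ (0 < r j → S.D j = 0)) ∧
    (S.decouplingMatrix r).rank = p

end StateSpace

/-- The McMillan degree: the minimal state dimension of a representation of `B`. -/
noncomputable def mcMillanDegree {m p : ℕ} (B : Set (ℕ → Signal m p)) : ℕ :=
  sInf {n : ℕ | ∃ S : StateSpace n m p, S.behavior = B}

/-- The lag: the least `K` such that the truncated observability matrix with `K` block rows of a
minimal representation of `B` has full column rank. -/
noncomputable def lag {m p : ℕ} (B : Set (ℕ → Signal m p)) : ℕ :=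
  sInf {K : ℕ | ∃ S : StateSpace (mcMillanDegree B) m p,
    S.behavior = B ∧ (S.observabilityMatrix K).rank = mcMillanDegree B}

/-- `B` has vector relative degree `r` (a property of any representation, as the impulse response
is the same for all representations of `B`). -/
def HasVectorRelDegree {m p : ℕ} (B : Set (ℕ → Signal m p)) (r : Fin p → ℕ) : Prop :=
  ∃ (n : ℕ) (S : StateSpace n m p), S.behavior = B ∧ S.HasVectorRelDegree r

/-- The relative degree of a single-input single-output behavior: that of any of its
representations. All representations share the impulse response, so the infimum runs over copies
of one and the same value. -/
noncomputable def relDegree (B : Set (ℕ → Signal 1 1)) : ℕ∞ :=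
  ⨅ (n : ℕ) (S : StateSpace n 1 1) (_ : S.behavior = B), S.relDegree

/-- The induced single-input single-output system: the pairs `(u_j, y_i)` for `(u, y)` in `B` with
`u_k = 0` for all `k ≠ j`. -/
def inducedSISO {m p : ℕ} (B : Set (ℕ → Signal m p)) (i : Fin p) (j : Fin m) :
    Set (ℕ → Signal 1 1) :=
  {s | ∃ w ∈ B, (∀ t, ∀ k, k ≠ j → (w t).1 k = 0) ∧
    ∀ t, s t = (fun _ => (w t).1 j, fun _ => (w t).2 i)}

/-- `r_i = min_j r_ij`, where `r_ij` is the relative degree of the `(i, j)` induced system. -/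
noncomputable def outputRelDegree {m p : ℕ} (B : Set (ℕ → Signal m p)) (i : Fin p) : ℕ∞ :=
  ⨅ j : Fin m, relDegree (inducedSISO B i j)

/-! ### Data -/

/-- `(u, y)` on the time interval `[0, T]` is the restriction of a trajectory of `B`. -/
def IsSampledFrom {m p T : ℕ} (B : Set (ℕ → Signal m p))
    (u : Fin (T + 1) → Fin m → ℝ) (y : Fin (T + 1) → Fin p → ℝ) : Prop :=
  ∃ w ∈ B, ∀ t : Fin (T + 1), w t = (u t, y t)

/-- The Hankel matrix of order `K` of a signal on `[0, T]`: the entry in block row `k`, component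
`c`, column `s` is `u(k + s)_c`; the columns are `s = 0, …, T - K + 1`. -/
def hankel {q T : ℕ} (K : ℕ) (u : Fin (T + 1) → Fin q → ℝ) :
    Matrix (Fin K × Fin q) (Fin (T + 2 - K)) ℝ :=
  Matrix.of fun kc s =>
    u ⟨(kc.1 : ℕ) + (s : ℕ), by have h1 := kc.1.isLt; have h2 := s.isLt; omega⟩ kc.2

/-- Persistency of excitation of order `K`. -/
def PersistentlyExciting {q T : ℕ} (K : ℕ) (u : Fin (T + 1) → Fin q → ℝ) : Prop :=
  K ≤ T + 1 ∧ (hankel K u).rank = K * q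

/-- `z = (z_0, …, z_(L-l-1))` solves, for some `g`, the system of linear equations
`H_L(u) g = (0_(m l), e_j, 0_(m (L-l-1)))`, `H_L(y) g = (0_(p l), z)`. -/
def IsDataImpulseOutput {m p T : ℕ} (u : Fin (T + 1) → Fin m → ℝ) (y : Fin (T + 1) → Fin p → ℝ)
    (L l : ℕ) (j : Fin m) (z : Fin (L - l) → Fin p → ℝ) : Prop :=
  ∃ g : Fin (T + 2 - L) → ℝ,
    (∀ (k : Fin L) (c : Fin m),
      (hankel L u).mulVec g (k, c) = if (k : ℕ) = l ∧ c = j then 1 else 0) ∧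
    (∀ (k : Fin L) (i : Fin p), (k : ℕ) < l → (hankel L y).mulVec g (k, i) = 0) ∧
    (∀ (k : Fin (L - l)) (i : Fin p),
      (hankel L y).mulVec g (⟨l + (k : ℕ), by have h := k.isLt; omega⟩, i) = z k i)

/-- The matrix with entries `a_ij = (z^(j)_(r_i))_i`. A row with `r_i = ∞` is zero by convention;
an index `r_i` outside the range of `z^(j)` is given the value zero as well, but does not occur. -/
noncomputable def dataMatrix {m p N : ℕ} (r : Fin p → ℕ∞) (z : Fin m → Fin N → Fin p → ℝ) :
    Matrix (Fin p) (Fin m) ℝ :=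
  Matrix.of fun i j =>
    if h : r i ≠ ⊤ ∧ (r i).toNat < N then z j ⟨(r i).toNat, h.2⟩ i else 0

end LTI

/-! The data recover the impulse response: the only solution `z` has as `z k i` the entry `(i, j)`
of its `k`th member. Hence `dataMatrix` is the decoupling matrix formed with the `r_i`, and the
criterion only has to be compared with the definition row by row.

The behavior is first realized on the space of its zero-input outputs (`exists_representation`).
This space is finite-dimensional because an output able to jump after arbitrarily long zero pasts
would be a further free component, against `inputCard B = m`. By dimension count a minimal
representation is observable (`observable_of_minimal`); behavioral controllability then makes it
reachable (`reachable_of_controllable`).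

Uniqueness of `z` is observability: `l` zero samples of input and output force a zero state, after
which the impulse produces the impulse response (`IsDataImpulseOutput.eq_impulseResponse`).
Existence is Willems' fundamental lemma: for a reachable pair, excitation of order `L + n` rules out
linear relations between the state and the next `L` inputs (`eq_zero_of_relation`), so windows of
the data span all initial states and inputs (`exists_combination`). Cayley–Hamilton gives `r_i ≤ n`,
and `impulseResponse_eq` gives independence of the representation. -/

namespace LTI

/-! ### Constructing trajectories step by step -/

section Steps

variable {W : Type*}

/-- Putting `T` zeros in front of a trajectory. -/
def delay [AddCommGroup W] (T : ℕ) (w : ℕ → W) : ℕ → W := fun t => if T ≤ t then w (t - T) else 0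

theorem delay_apply_add [AddCommGroup W] (T : ℕ) (w : ℕ → W) (t : ℕ) : delay T w (t + T) = w t := by
  simp [delay]

theorem delay_apply_of_lt [AddCommGroup W] {T t : ℕ} (w : ℕ → W) (h : t < T) : delay T w t = 0 := by
  simp [delay, h]

theorem shift_mem [AddCommGroup W] [Module ℝ W] {V : Submodule ℝ (ℕ → W)} (hsh : ∀ w ∈ V, (fun t => w (t + 1)) ∈ V)
    {w : ℕ → W} (hw : w ∈ V) (k : ℕ) : (fun t => w (t + k)) ∈ V := by
  induction k with
  | zero => simpa using hw
  | succ k ih =>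
    have := hsh _ ih
    simpa [add_assoc, add_comm 1 k] using this

/-- A sequence of trajectories, each of which keeps the past of its predecessor, has a limit. -/
theorem exists_limit [TopologicalSpace W] {V : Set (ℕ → W)} (hcl : IsClosed V) (v : ℕ → ℕ → W) (hv : ∀ N, v N ∈ V)
    (hag : ∀ N, ∀ t < N, v (N + 1) t = v N t) :
    ∃ w ∈ V, ∀ N, ∀ t < N, w t = v N t := by
  have key : ∀ N t, t < N → v N t = v (t + 1) t := by
    intro N t h
    induction N, h using Nat.le_induction with
    | base => rfl
    | succ N hN ih => rw [hag N t hN, ih]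
  refine ⟨fun t => v (t + 1) t, ?_, fun N t h => (key N t h).symm⟩
  refine hcl.mem_of_tendsto (f := v) (b := Filter.atTop) ?_ (Filter.Eventually.of_forall hv)
  refine tendsto_pi_nhds.2 fun t => ?_
  refine tendsto_const_nhds.congr' ?_
  filter_upwards [Filter.eventually_gt_atTop t] with N hN using (key N t hN).symm

/-- A pointwise condition on the future that can be met one step at a time can be met. -/
theorem exists_mem_of_step [TopologicalSpace W] {V : Set (ℕ → W)} (hcl : IsClosed V) (P : ℕ → W → Prop)
    {w₀ : ℕ → W} (hw₀ : w₀ ∈ V) (T : ℕ)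
    (step : ∀ N, T ≤ N → ∀ v ∈ V, (∀ t < T, v t = w₀ t) → (∀ t, T ≤ t → t < N → P t (v t)) →
      ∃ v' ∈ V, (∀ t < N, v' t = v t) ∧ P N (v' N)) :
    ∃ w ∈ V, (∀ t < T, w t = w₀ t) ∧ ∀ t, T ≤ t → P t (w t) := by
  have step' : ∀ N, ∀ v : {v : ℕ → W // v ∈ V ∧ (∀ t < T, v t = w₀ t) ∧
      ∀ t, T ≤ t → t < T + N → P t (v t)}, ∃ v' : {v : ℕ → W // v ∈ V ∧ (∀ t < T, v t = w₀ t) ∧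
      ∀ t, T ≤ t → t < T + (N + 1) → P t (v t)}, ∀ t < T + N, v'.1 t = v.1 t := by
    rintro N ⟨v, hv, h1, h2⟩
    obtain ⟨v', hv', h3, h4⟩ := step (T + N) (by omega) v hv h1 h2
    refine ⟨⟨v', hv', fun t ht => by rw [h3 t (by omega), h1 t ht], fun t ht ht' => ?_⟩, h3⟩
    rcases (by omega : t < T + N ∨ t = T + N) with h | rfl
    · rw [h3 t h]; exact h2 t ht h
    · exact h4
  choose next hnext using step'
  let s : ∀ N, {v : ℕ → W // v ∈ V ∧ (∀ t < T, v t = w₀ t) ∧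
      ∀ t, T ≤ t → t < T + N → P t (v t)} := fun N =>
    Nat.rec ⟨w₀, hw₀, fun _ _ => rfl, fun t h h' => absurd h' (not_lt.2 h)⟩ (fun N v => next N v) N
  obtain ⟨w, hw, hws⟩ := exists_limit hcl (fun N => (s N).1) (fun N => (s N).2.1)
    (fun N t ht => hnext N (s N) t (by omega))
  refine ⟨w, hw, fun t ht => ?_, fun t ht => ?_⟩
  · rw [hws (t + 1) t (by omega)]; exact (s (t + 1)).2.2.1 t ht
  · rw [hws (t + 1) t (by omega)]; exact (s (t + 1)).2.2.2 t ht (by omega)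

theorem mem_of_forall_agree [TopologicalSpace W] {V : Set (ℕ → W)} (hcl : IsClosed V) {w : ℕ → W}
    (h : ∀ N, ∃ v ∈ V, ∀ t < N, v t = w t) : w ∈ V := by
  choose v hv hvw using h
  obtain ⟨w', hw', h'⟩ := exists_limit hcl v hv
    (fun N t ht => by rw [hvw _ t (by omega), hvw _ t ht])
  convert hw' using 1
  ext t
  rw [h' (t + 1) t (by omega), hvw _ t (by omega)]

variable [AddCommGroup W] [Module ℝ W]

/-- The values at time `t` of the trajectories that vanish before time `t`. -/
def jumpSpace (V : Submodule ℝ (ℕ → W)) (t : ℕ) : Submodule ℝ W where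
  carrier := {a | ∃ w ∈ V, (∀ s < t, w s = 0) ∧ w t = a}
  zero_mem' := ⟨0, V.zero_mem, fun _ _ => rfl, rfl⟩
  add_mem' := by
    rintro a b ⟨w, hw, hw0, rfl⟩ ⟨v, hv, hv0, rfl⟩
    exact ⟨w + v, V.add_mem hw hv, fun s hs => by simp [hw0 s hs, hv0 s hs], rfl⟩
  smul_mem' := by
    rintro c a ⟨w, hw, hw0, rfl⟩
    exact ⟨c • w, V.smul_mem c hw, fun s hs => by simp [hw0 s hs], rfl⟩

theorem jumpSpace_antitone {V : Submodule ℝ (ℕ → W)}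
    (hsh : ∀ w ∈ V, (fun t => w (t + 1)) ∈ V) : Antitone (jumpSpace V) := by
  refine antitone_nat_of_succ_le fun t => ?_
  rintro a ⟨w, hw, hw0, rfl⟩
  exact ⟨_, hsh w hw, fun s hs => hw0 (s + 1) (by omega), rfl⟩

theorem exists_jumpSpace_stable [FiniteDimensional ℝ W] {V : Submodule ℝ (ℕ → W)}
    (hsh : ∀ w ∈ V, (fun t => w (t + 1)) ∈ V) :
    ∃ K, ∀ t, K ≤ t → jumpSpace V t = jumpSpace V K := by
  obtain ⟨K, hK⟩ := WellFoundedGT.monotone_chain_condition (α := (Submodule ℝ W)ᵒᵈ)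
    ⟨fun t => OrderDual.toDual (jumpSpace V t), fun a b h => jumpSpace_antitone hsh h⟩
  exact ⟨K, fun t ht => (hK t ht).symm⟩

/-- On a one-sided time axis a zero past cannot be lengthened for free. Once the jump spaces have
stabilized, every correction possible at one late time is possible at all later ones, so the delayed
trajectory can be rebuilt step by step. -/
theorem delay_mem [TopologicalSpace W] {V : Submodule ℝ (ℕ → W)} (hcl : IsClosed (V : Set (ℕ → W)))
    (hsh : ∀ w ∈ V, (fun t => w (t + 1)) ∈ V) {K : ℕ}
    (hK : ∀ t, K ≤ t → jumpSpace V t = jumpSpace V K) {w : ℕ → W} (hw : delay K w ∈ V) (T : ℕ) :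
    delay T w ∈ V := by
  wlog hT : K ≤ T generalizing T
  · have := shift_mem hsh (this K le_rfl) (K - T)
    convert this using 1
    ext t
    simp only [delay]
    split_ifs with h1 h2 h2
    · congr 1; omega
    · omega
    · omega
    · rfl
  obtain ⟨w', hw', h1, h2⟩ := exists_mem_of_step hcl (fun t a => a = delay T w t) V.zero_mem T (by
    intro N hN v hv hv0 hvw
    -- Both trajectories are aligned to start at time `K`. They agree as far as `v` is already
    -- correct, so their difference is a jump whose value is the error of `v` at `N`.
    have hmem : (delay K w - fun t => v (t + (T - K))) ∈ V :=
      V.sub_mem hw (shift_mem hsh hv _)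
    have hj : delay T w N - v N ∈ jumpSpace V (N - T + K) := by
      refine ⟨_, hmem, fun s hs => ?_, ?_⟩
      · rcases lt_or_ge s K with h | h
        · simp [delay_apply_of_lt w h, hv0 (s + (T - K)) (by omega)]
        · have := hvw (s + (T - K)) (by omega) (by omega)
          simp only [Pi.sub_apply, this]
          simp only [delay, h, if_true, show T ≤ s + (T - K) by omega]
          rw [show s + (T - K) - T = s - K by omega, sub_self]
      · simp only [Pi.sub_apply, show N - T + K + (T - K) = N by omega]
        simp [delay, hN]
    -- Both times are at least `K`, so the same value is a jump at time `N`.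
    rw [hK _ (by omega), ← hK N (by omega)] at hj
    obtain ⟨c, hc, hc0, hcN⟩ := hj
    exact ⟨v + c, V.add_mem hv hc, fun t ht => by simp [hc0 t ht], by simp [hcN]⟩)
  have : delay T w = w' := by
    ext1 t
    rcases lt_or_ge t T with h | h
    · rw [h1 t h, delay_apply_of_lt w h]; rfl
    · exact (h2 t h).symm
  exact this ▸ hw'

end Steps

/-! ### Realization -/

section Realization

variable {m p : ℕ}

theorem bddAbove_free (B : Set (ℕ → Signal m p)) (hne : B.Nonempty) :
    BddAbove {d : ℕ | ∃ π : Signal m p →ₗ[ℝ] (Fin d → ℝ), IsFree B π} := by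
  refine ⟨m + p, ?_⟩
  rintro d ⟨π, hπ⟩
  obtain ⟨w, hw⟩ := hne
  have hs : Function.Surjective π := by
    intro a
    obtain ⟨w', -, -, h⟩ := hπ w hw 0 (fun _ => a)
    exact ⟨_, h 0 le_rfl⟩
  simpa using LinearMap.finrank_le_finrank_of_surjective hs

/-- Values reached by jumps after arbitrarily long zero pasts have a nonzero output only together
with a nonzero input, as the input is a maximal set of free components. -/
theorem snd_eq_zero_of_mem_jumpSpace {B : Set (ℕ → Signal m p)} (hB : IsSystem B)
    {V : Submodule ℝ (ℕ → Signal m p)} (hV : (V : Set (ℕ → Signal m p)) = B) {y : Fin p → ℝ}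
    (hy : ∀ t, ((0, y) : Signal m p) ∈ jumpSpace V t) : y = 0 := by
  subst hV
  by_contra hne
  obtain ⟨i, hi⟩ := Function.ne_iff.1 hne
  let π : Signal m p →ₗ[ℝ] (Fin (m + 1) → ℝ) :=
    LinearMap.pi (Fin.snoc (α := fun _ => Signal m p →ₗ[ℝ] ℝ)
      (fun j => LinearMap.proj j ∘ₗ LinearMap.fst ℝ (Fin m → ℝ) (Fin p → ℝ))
      (LinearMap.proj i ∘ₗ LinearMap.snd ℝ (Fin m → ℝ) (Fin p → ℝ)))
  have hfree : IsFree (V : Set (ℕ → Signal m p)) π := by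
    intro w hw T f
    refine exists_mem_of_step hB.complete (fun t a => π a = f t) hw T ?_
    intro N _ v hv _ _
    obtain ⟨v', hv', h1, h2⟩ := hB.input_free v hv N (fun _ j => f N j.castSucc)
    obtain ⟨c, hc, hc0, hcN⟩ := hy N
    -- The jump `c` has zero input and nonzero `i`th output at `N`, so a multiple of it corrects
    -- that output without disturbing the inputs.
    refine ⟨v' + ((f N (Fin.last m) - (v' N).2 i) / y i) • c, V.add_mem hv' (V.smul_mem _ hc),
      fun t ht => by simp [hc0 t ht, h1 t ht], ?_⟩
    ext j
    refine Fin.lastCases ?_ (fun j => ?_) j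
    · have : y i ≠ 0 := hi
      simp [π, hcN]
      field_simp
      ring
    · have := congrFun (h2 N le_rfl) j
      simp only [LinearMap.fst_apply] at this
      simp [π, hcN, this]
  have := le_csSup (bddAbove_free (V : Set (ℕ → Signal m p)) ⟨0, V.zero_mem⟩) ⟨π, hfree⟩
  have h2 := hB.input_card
  rw [inputCard] at h2
  omega

/-- The output trajectories of a behavior for the input zero. -/
def zeroInputSpace (V : Submodule ℝ (ℕ → Signal m p)) : Submodule ℝ (ℕ → Fin p → ℝ) where
  carrier := {y | (fun t => ((0, y t) : Signal m p)) ∈ V}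
  zero_mem' := V.zero_mem
  add_mem' := by
    intro a b ha hb
    have := V.add_mem ha hb
    change _ ∈ V
    convert this using 1
    ext t <;> simp
  smul_mem' := by
    intro c a ha
    have := V.smul_mem c ha
    change _ ∈ V
    convert this using 1
    ext t <;> simp

theorem mem_zeroInputSpace {V : Submodule ℝ (ℕ → Signal m p)} {y : ℕ → Fin p → ℝ} :
    y ∈ zeroInputSpace V ↔ (fun t => ((0, y t) : Signal m p)) ∈ V := Iff.rfl

theorem finiteDimensional_zeroInputSpace {B : Set (ℕ → Signal m p)} (hB : IsSystem B)
    {V : Submodule ℝ (ℕ → Signal m p)} (hV : (V : Set (ℕ → Signal m p)) = B) :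
    FiniteDimensional ℝ (zeroInputSpace V) := by
  have hsh : ∀ w ∈ V, (fun t => w (t + 1)) ∈ V := by
    intro w hw
    have := hB.shift w (hV ▸ hw)
    rwa [← hV] at this
  obtain ⟨K, hK⟩ := exists_jumpSpace_stable hsh
  -- Injective: a response vanishing on `[0, K)` has as first nonzero value a jump at a time `≥ K`,
  -- hence a jump with zero input at every time.
  let R : zeroInputSpace V →ₗ[ℝ] (Fin K → Fin p → ℝ) :=
    LinearMap.pi fun k => LinearMap.proj (k : ℕ) ∘ₗ (zeroInputSpace V).subtype
  refine FiniteDimensional.of_injective R ((injective_iff_map_eq_zero R).2 ?_)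
  rintro ⟨y, hy⟩ h0
  have h1 : ∀ t < K, y t = 0 := fun t ht => congrFun h0 ⟨t, ht⟩
  have h2 : ∀ t, y t = 0 := by
    intro t
    induction t using Nat.strong_induction_on with
    | _ t ih =>
      rcases lt_or_ge t K with h | h
      · exact h1 t h
      · refine snd_eq_zero_of_mem_jumpSpace hB hV fun s => ?_
        have : ((0, y t) : Signal m p) ∈ jumpSpace V t :=
          ⟨_, hy, fun s hs => by simp [ih s hs], rfl⟩
        rcases le_total s t with hs | hs
        · exact jumpSpace_antitone hsh hs this
        · rwa [hK s (h.trans hs), ← hK t h]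
  ext1
  exact funext h2

/-- Impulse responses: an input impulse after an arbitrarily long zero past. -/
theorem exists_impulse_response {B : Set (ℕ → Signal m p)} (hB : IsSystem B)
    {V : Submodule ℝ (ℕ → Signal m p)} (hV : (V : Set (ℕ → Signal m p)) = B) :
    ∃ H : (Fin m → ℝ) →ₗ[ℝ] (ℕ → Fin p → ℝ), ∀ v T,
      delay T (fun t => ((if t = 0 then v else 0, H v t) : Signal m p)) ∈ V := by
  subst hV
  have hsh : ∀ w ∈ V, (fun t => w (t + 1)) ∈ V := hB.shift
  obtain ⟨K, hK⟩ := exists_jumpSpace_stable hsh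
  have h1 : ∀ j : Fin m, ∃ h : ℕ → Fin p → ℝ, ∀ T,
      delay T (fun t => ((if t = 0 then Pi.single j 1 else 0, h t) : Signal m p)) ∈ V := by
    intro j
    obtain ⟨w, hw, hw0, hwu⟩ := hB.input_free 0 V.zero_mem K
      (fun t => if t = K then Pi.single j 1 else 0)
    refine ⟨fun t => (w (t + K)).2, delay_mem hB.complete hsh hK ?_⟩
    convert SetLike.mem_coe.1 hw using 1
    funext t
    rcases lt_or_ge t K with h | h
    · rw [delay_apply_of_lt _ h, hw0 t h]; rfl
    · obtain ⟨s, rfl⟩ := Nat.exists_eq_add_of_le' h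
      rw [delay_apply_add]
      have := hwu (s + K) h
      simp only [LinearMap.fst_apply] at this
      refine Prod.ext ?_ rfl
      simp [this]
  choose h hh using h1
  refine ⟨Fintype.linearCombination ℝ h, fun v T => ?_⟩
  have := V.sum_mem (t := Finset.univ) (fun j _ => V.smul_mem (v j) (hh j T))
  convert this using 1
  funext t
  rcases lt_or_ge t T with ht | ht
  · simp [delay_apply_of_lt _ ht]
  · obtain ⟨s, rfl⟩ := Nat.exists_eq_add_of_le' ht
    simp only [Finset.sum_apply, Pi.smul_apply, delay_apply_add, Fintype.linearCombination_apply]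
    refine Prod.ext ?_ ?_
    · rw [Prod.fst_sum]
      split_ifs with hs
      · simpa using pi_eq_sum_univ' v
      · simp
    · rw [Prod.snd_sum]; simp

theorem StateSpace.add_mem_behavior {n : ℕ} (S : StateSpace n m p) {w v : ℕ → Signal m p}
    (hw : w ∈ S.behavior) (hv : v ∈ S.behavior) : w + v ∈ S.behavior := by
  obtain ⟨x, hx⟩ := hw
  obtain ⟨x', hx'⟩ := hv
  refine ⟨x + x', fun t => ⟨?_, ?_⟩⟩
  · simp only [Pi.add_apply, Prod.fst_add, Matrix.mulVec_add, (hx t).1, (hx' t).1]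
    abel
  · simp only [Pi.add_apply, Prod.fst_add, Prod.snd_add, Matrix.mulVec_add, (hx t).2, (hx' t).2]
    abel

/-- The trajectory with initial state `x₀` and input `u`. -/
theorem StateSpace.exists_state {n : ℕ} (S : StateSpace n m p) (x₀ : Fin n → ℝ)
    (u : ℕ → Fin m → ℝ) : ∃ x : ℕ → Fin n → ℝ, x 0 = x₀ ∧
      ∀ t, x (t + 1) = S.A.mulVec (x t) + S.B.mulVec (u t) :=
  ⟨fun t => Nat.rec x₀ (fun t x => S.A.mulVec x + S.B.mulVec (u t)) t, rfl, fun _ => rfl⟩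

/-- Every system has a state space representation on the space of its zero-input responses. -/
theorem exists_representation {B : Set (ℕ → Signal m p)} (hB : IsSystem B)
    {V : Submodule ℝ (ℕ → Signal m p)} (hV : (V : Set (ℕ → Signal m p)) = B) :
    ∃ S : StateSpace (Module.finrank ℝ (zeroInputSpace V)) m p, S.behavior = B := by
  have := finiteDimensional_zeroInputSpace hB hV
  obtain ⟨H, hH⟩ := exists_impulse_response hB hV
  subst hV
  have hsh : ∀ w ∈ V, (fun t => w (t + 1)) ∈ V := hB.shift
  let e : zeroInputSpace V ≃ₗ[ℝ] (Fin (Module.finrank ℝ (zeroInputSpace V)) → ℝ) :=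
    (Module.finBasis ℝ (zeroInputSpace V)).equivFun
  let σ : (ℕ → Fin p → ℝ) →ₗ[ℝ] (ℕ → Fin p → ℝ) := LinearMap.funLeft ℝ _ (fun t => t + 1)
  have hσ : ∀ y t, σ y t = y (t + 1) := fun _ _ => rfl
  let Aσ : zeroInputSpace V →ₗ[ℝ] zeroInputSpace V :=
    σ.restrict (fun y hy => hsh _ hy)
  -- A state is the future output under zero input; after an impulse this is the tail of its
  -- response.
  let Bσ : (Fin m → ℝ) →ₗ[ℝ] zeroInputSpace V := (σ ∘ₗ H).codRestrict _ (fun v => by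
    have := hsh _ (hH v 0)
    rw [LinearMap.comp_apply, mem_zeroInputSpace]
    simpa [delay, hσ] using this)
  let S : StateSpace (Module.finrank ℝ (zeroInputSpace V)) m p :=
    { A := LinearMap.toMatrix' (e.toLinearMap ∘ₗ Aσ ∘ₗ e.symm.toLinearMap)
      B := LinearMap.toMatrix' (e.toLinearMap ∘ₗ Bσ)
      C := LinearMap.toMatrix' (LinearMap.proj 0 ∘ₗ (zeroInputSpace V).subtype ∘ₗ
        e.symm.toLinearMap)
      D := LinearMap.toMatrix' (LinearMap.proj 0 ∘ₗ H) }
  have hA : ∀ x, e.symm (S.A.mulVec x) = Aσ (e.symm x) := fun x => by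
    simp [S, LinearMap.toMatrix'_mulVec]
  have hBm : ∀ v, e.symm (S.B.mulVec v) = Bσ v := fun v => by
    simp [S, LinearMap.toMatrix'_mulVec]
  have hC : ∀ x, S.C.mulVec x = (e.symm x).1 0 := fun x => by
    simp [S, LinearMap.toMatrix'_mulVec]
  have hD : ∀ v, S.D.mulVec v = H v 0 := fun v => by
    simp [S, LinearMap.toMatrix'_mulVec]
  have hsub : S.behavior ⊆ (V : Set (ℕ → Signal m p)) := by
    rintro w ⟨x, hx⟩
    -- `v` follows `w` before time `N` and then continues with zero input; adding a delayed impulse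
    -- response feeds in the next input.
    have key : ∀ N, ∃ v ∈ V, (∀ t < N, v t = w t) ∧
        ∀ t, v (t + N) = ((0, (e.symm (x N)).1 t) : Signal m p) := by
      intro N
      induction N with
      | zero =>
        refine ⟨_, mem_zeroInputSpace.1 (e.symm (x 0)).2, fun t ht => by omega, fun t => rfl⟩
      | succ N ih =>
        obtain ⟨v, hv, h1, h2⟩ := ih
        refine ⟨_, V.add_mem hv (hH (w N).1 N), fun t ht => ?_, fun t => ?_⟩
        · rcases (by omega : t < N ∨ t = N) with h | rfl
          · simp [delay_apply_of_lt _ h, h1 t h]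
          · have h3 := h2 0
            rw [zero_add] at h3
            have h4 : delay t (fun s => ((if s = 0 then (w t).1 else 0, H (w t).1 s) : Signal m p)) t
              = ((w t).1, H (w t).1 0) := by simp [delay]
            rw [Pi.add_apply, h3, h4]
            refine Prod.ext (by simp) ?_
            rw [(hx t).2, hC, hD]; rfl
        · rw [show t + (N + 1) = (t + 1) + N by omega, Pi.add_apply, h2, delay_apply_add,
            (hx N).1, map_add, hA, hBm]
          refine Prod.ext (by simp) rfl
    refine mem_of_forall_agree hB.complete fun N => ?_
    obtain ⟨v, hv, h1, -⟩ := key N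
    exact ⟨v, hv, h1⟩
  refine ⟨S, hsub.antisymm fun w hw => ?_⟩
  -- Subtracting the response to the same input from state zero leaves a zero-input trajectory,
  -- whose state is the trajectory itself, moved by the shift.
  obtain ⟨x, hx0, hx⟩ := S.exists_state 0 (fun t => (w t).1)
  have h1 : (fun t => ((w t).1, S.C.mulVec (x t) + S.D.mulVec (w t).1)) ∈ S.behavior :=
    ⟨x, fun t => ⟨hx t, rfl⟩⟩
  have h2 := V.sub_mem hw (hsub h1)
  set d : ℕ → Fin p → ℝ := fun t => (w t).2 - (S.C.mulVec (x t) + S.D.mulVec (w t).1)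
  have hd : d ∈ zeroInputSpace V := by
    rw [mem_zeroInputSpace]
    convert h2 using 1
    funext t
    exact Prod.ext (by simp) rfl
  have h3 : (fun t => ((0, d t) : Signal m p)) ∈ S.behavior := by
    refine ⟨fun t => e ((Aσ ^ t) ⟨d, hd⟩), fun t => ⟨?_, ?_⟩⟩
    · apply e.symm.injective
      simp [hA, pow_succ']
    · have : ∀ t s, ((Aσ ^ t) ⟨d, hd⟩).1 s = d (s + t) := by
        intro t
        induction t with
        | zero => intro s; simp
        | succ t ih =>
          intro s
          rw [pow_succ', Module.End.mul_apply]
          change ((Aσ ^ t) ⟨d, hd⟩).1 (s + 1) = _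
          rw [ih]
          congr 1; omega
      simp [hC, this]
  have := S.add_mem_behavior h1 h3
  convert this using 1
  funext t
  refine Prod.ext (by simp) ?_
  simp [d]

end Realization

/-! ### Linear algebra -/

section LinearAlgebra

/-- By Cayley–Hamilton, a linear map that vanishes on `A ^ k` for `k < n` vanishes on all powers
of the `n × n` matrix `A`. -/
theorem map_pow_eq_zero {n : ℕ} {M : Type*} [AddCommGroup M] [Module ℝ M]
    (A : Matrix (Fin n) (Fin n) ℝ) (φ : Matrix (Fin n) (Fin n) ℝ →ₗ[ℝ] M)
    (h : ∀ k < n, φ (A ^ k) = 0) (k : ℕ) : φ (A ^ k) = 0 := by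
  rw [Matrix.pow_eq_aeval_mod_charpoly, Polynomial.aeval_eq_sum_range, map_sum]
  refine Finset.sum_eq_zero fun i _ => ?_
  rw [map_smul]
  rcases lt_or_ge i n with hi | hi
  · rw [h i hi, smul_zero]
  · have hd : (Polynomial.X ^ k %ₘ A.charpoly).degree < (n : ℕ) := by
      have := Polynomial.degree_modByMonic_lt (Polynomial.X ^ k) A.charpoly_monic
      rwa [Matrix.charpoly_degree_eq_dim, Fintype.card_fin] at this
    rw [Polynomial.coeff_eq_zero_of_degree_lt (hd.trans_le (by exact_mod_cast hi)), zero_smul]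

theorem vecMul_injective_of_rank_eq_card {ι κ : Type*} [Fintype ι] [Fintype κ] {M : Matrix ι κ ℝ}
    (h : M.rank = Fintype.card ι) : Function.Injective M.vecMul := by
  rw [Matrix.vecMul_injective_iff, linearIndependent_iff_card_eq_finrank_span,
    ← h, Matrix.rank_eq_finrank_span_row]
  rfl

theorem mulVec_surjective_of_vecMul_eq_zero {ι κ : Type*} [Fintype ι] [Fintype κ]
    {M : Matrix ι κ ℝ} (h : ∀ v, Matrix.vecMul v M = 0 → v = 0) :
    Function.Surjective M.mulVec := by
  have hi : Function.Injective M.vecMulLinear := (injective_iff_map_eq_zero _).2 h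
  have hr := (Matrix.vecMul_injective_iff.1 hi).rank_matrix
  have : M.mulVecLin.range = ⊤ := by
    apply Submodule.eq_top_of_finrank_eq
    rw [Module.finrank_fintype_fun_eq_card, ← hr]
    rfl
  exact LinearMap.range_eq_top.1 this

theorem mulVec_eq_zero_of_rank_eq_card {ι κ : Type*} [Fintype ι] [Fintype κ] {M : Matrix ι κ ℝ}
    (h : M.rank = Fintype.card κ) {v : κ → ℝ} (hv : M.mulVec v = 0) : v = 0 := by
  have h' : M.transpose.rank = Fintype.card κ := by rw [Matrix.rank_transpose, h]
  refine vecMul_injective_of_rank_eq_card h' ?_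
  simpa [Matrix.vecMul_transpose] using hv

theorem rank_eq_card_of_mulVec_eq_zero {ι κ : Type*} [Fintype ι] [Fintype κ] {M : Matrix ι κ ℝ}
    (h : ∀ v, M.mulVec v = 0 → v = 0) : M.rank = Fintype.card κ := by
  rw [← Matrix.rank_transpose]
  refine LinearIndependent.rank_matrix (Matrix.vecMul_injective_iff.1 ?_)
  refine (injective_iff_map_eq_zero M.transpose.vecMulLinear).2 fun v hv => h v ?_
  simpa [Matrix.vecMul_transpose] using hv

theorem mulVec_eq_of_support {ι κ : Type*} [Fintype κ] (M : Matrix ι κ ℝ) {v : κ → ℝ} {j : κ}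
    (hv : ∀ k, k ≠ j → v k = 0) : M.mulVec v = fun a => M a j * v j := by
  classical
  funext a
  exact Finset.sum_eq_single j (fun k _ hk => by rw [hv k hk, mul_zero])
    fun h => absurd (Finset.mem_univ j) h

end LinearAlgebra

/-! ### Trajectories of state space representations -/

namespace StateSpace

variable {n m p : ℕ} (S : StateSpace n m p)

theorem state_of_zero_input {x : ℕ → Fin n → ℝ} {u : ℕ → Fin m → ℝ}
    (hx : ∀ t, x (t + 1) = S.A.mulVec (x t) + S.B.mulVec (u t)) {t₀ : ℕ} (k : ℕ)
    (hu : ∀ t, t₀ ≤ t → t < t₀ + k → u t = 0) : x (t₀ + k) = (S.A ^ k).mulVec (x t₀) := by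
  induction k with
  | zero => simp
  | succ k ih =>
    rw [← add_assoc, hx, ih fun t h h' => hu t h (by omega), hu (t₀ + k) (by omega) (by omega),
      pow_succ', Matrix.mulVec_zero, add_zero, Matrix.mulVec_mulVec]

/-- The output after an input at time `t₀` only. -/
theorem output_after_impulse {x : ℕ → Fin n → ℝ} {w : ℕ → Signal m p}
    (hx : ∀ t, x (t + 1) = S.A.mulVec (x t) + S.B.mulVec (w t).1 ∧
      (w t).2 = S.C.mulVec (x t) + S.D.mulVec (w t).1) {t₀ : ℕ} (k : ℕ)
    (hu : ∀ t, t₀ < t → t ≤ t₀ + k → (w t).1 = 0) :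
    (w (t₀ + k)).2 = (S.C * S.A ^ k).mulVec (x t₀) + (S.impulseResponse k).mulVec (w t₀).1 := by
  cases k with
  | zero => simpa [impulseResponse] using (hx t₀).2
  | succ k =>
    have h1 := S.state_of_zero_input (u := fun t => (w t).1) (fun t => (hx t).1) (t₀ := t₀ + 1) k
      (fun t h h' => hu t (by omega) (by omega))
    rw [show t₀ + (k + 1) = t₀ + 1 + k by omega, (hx _).2, h1,
      hu (t₀ + 1 + k) (by omega) (by omega), (hx t₀).1, Matrix.mulVec_zero, add_zero]
    simp only [impulseResponse, Matrix.mulVec_mulVec, Matrix.mulVec_add, pow_succ, Matrix.mul_assoc]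

theorem exists_trajectory (x₀ : Fin n → ℝ) (u : ℕ → Fin m → ℝ) :
    ∃ (x : ℕ → Fin n → ℝ) (w : ℕ → Signal m p), x 0 = x₀ ∧ (∀ t, (w t).1 = u t) ∧
      w ∈ S.behavior ∧ ∀ t, x (t + 1) = S.A.mulVec (x t) + S.B.mulVec (w t).1 ∧
      (w t).2 = S.C.mulVec (x t) + S.D.mulVec (w t).1 := by
  obtain ⟨x, hx0, hx⟩ := S.exists_state x₀ u
  exact ⟨x, fun t => (u t, S.C.mulVec (x t) + S.D.mulVec (u t)), hx0, fun _ => rfl,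
    ⟨x, fun t => ⟨hx t, rfl⟩⟩, fun t => ⟨hx t, rfl⟩⟩

theorem unobservable_of_lt {x : Fin n → ℝ} (h : ∀ k < n, (S.C * S.A ^ k).mulVec x = 0) (k : ℕ) :
    (S.C * S.A ^ k).mulVec x = 0 := by
  let φ : Matrix (Fin n) (Fin n) ℝ →ₗ[ℝ] (Fin p → ℝ) :=
    { toFun := fun M => (S.C * M).mulVec x
      map_add' := fun M N => by rw [Matrix.mul_add, Matrix.add_mulVec]
      map_smul' := fun c M => by simp [Matrix.smul_mulVec] }
  exact map_pow_eq_zero S.A φ h k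

/-- The impulse response is a property of the behavior. -/
theorem impulseResponse_eq {n' : ℕ} {S' : StateSpace n' m p} (h : S.behavior = S'.behavior)
    (k : ℕ) : S.impulseResponse k = S'.impulseResponse k := by
  refine Matrix.mulVec_injective (funext fun v => ?_)
  -- The impulse is preceded by `n'` zero samples: they make the initial state of `S'` unobservable,
  -- so it contributes nothing to the later output. `S'` itself need not be observable.
  obtain ⟨x, w, hx0, hwu, hw, hx⟩ := S.exists_trajectory 0 (fun t => if t = n' then v else 0)
  have hu1 : ∀ t, t < n' → (w t).1 = 0 := fun t ht => by rw [hwu, if_neg (by omega)]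
  have hu2 : ∀ t, n' < t → (w t).1 = 0 := fun t ht => by rw [hwu, if_neg (by omega)]
  have hun : (w n').1 = v := by rw [hwu, if_pos rfl]
  obtain ⟨x', hx'⟩ := h ▸ hw
  have e1 := S.output_after_impulse hx (t₀ := n') k fun t ht _ => hu2 t ht
  have e2 := S'.output_after_impulse hx' (t₀ := n') k fun t ht _ => hu2 t ht
  have s1 := S.state_of_zero_input (u := fun t => (w t).1) (fun t => (hx t).1) (t₀ := 0) n'
    (fun t _ ht => hu1 t (by omega))
  have s2 := S'.state_of_zero_input (u := fun t => (w t).1) (fun t => (hx' t).1) (t₀ := 0) n'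
    (fun t _ ht => hu1 t (by omega))
  rw [zero_add] at s1 s2
  have hz : ∀ t < n', (w t).2 = 0 := by
    intro t ht
    have := S.output_after_impulse hx (t₀ := 0) t fun t _ h => hu1 t (by omega)
    rw [zero_add, hx0, hu1 0 (by omega)] at this
    simpa using this
  have hno : ∀ k, (S'.C * S'.A ^ k).mulVec (x' 0) = 0 := by
    refine S'.unobservable_of_lt fun k hk => ?_
    have := S'.output_after_impulse hx' (t₀ := 0) k fun t _ h => hu1 t (by omega)
    rw [zero_add, hz k hk, hu1 0 (by omega)] at this
    simpa using this.symm
  rw [e2, s1, s2, hx0, hun, Matrix.mulVec_mulVec, Matrix.mul_assoc, ← pow_add, hno] at e1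
  simpa using e1.symm

/-- The `(i, j)` subsystem. -/
def siso (i : Fin p) (j : Fin m) : StateSpace n 1 1 where
  A := S.A
  B := Matrix.of fun a _ => S.B a j
  C := Matrix.of fun _ a => S.C i a
  D := Matrix.of fun _ _ => S.D i j

theorem impulseResponse_siso (i : Fin p) (j : Fin m) (k : ℕ) (a b : Fin 1) :
    (S.siso i j).impulseResponse k a b = S.impulseResponse k i j := by
  cases k with
  | zero => rfl
  | succ k => simp [siso, impulseResponse, Matrix.mul_apply]

theorem behavior_siso (i : Fin p) (j : Fin m) :
    (S.siso i j).behavior = inducedSISO S.behavior i j := by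
  ext s
  constructor
  · rintro ⟨x, hx⟩
    have h0 : ∀ t k, k ≠ j → (Pi.single j ((s t).1 0) : Fin m → ℝ) k = 0 := fun t k hk => by
      simp [hk]
    refine ⟨fun t => (Pi.single j ((s t).1 0),
      S.C.mulVec (x t) + S.D.mulVec (Pi.single j ((s t).1 0))), ⟨x, fun t => ⟨?_, rfl⟩⟩, h0,
      fun t => ?_⟩
    · rw [(hx t).1, mulVec_eq_of_support _ (h0 t)]
      funext a
      simp [siso, Matrix.mulVec, dotProduct]
    · refine Prod.ext ?_ ?_
      · funext a; simp [Subsingleton.elim a 0]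
      · rw [(hx t).2]
        change _ = fun _ : Fin 1 =>
          (S.C.mulVec (x t) + S.D.mulVec (Pi.single j ((s t).1 0))) i
        rw [mulVec_eq_of_support _ (h0 t)]
        funext a
        simp [siso, Matrix.mulVec, dotProduct]
  · rintro ⟨w, ⟨x, hx⟩, h0, hs⟩
    refine ⟨x, fun t => ⟨?_, ?_⟩⟩
    · rw [(hx t).1, mulVec_eq_of_support _ (h0 t), hs]
      funext a
      simp [siso, Matrix.mulVec, dotProduct]
    · rw [hs, (hx t).2, mulVec_eq_of_support _ (h0 t)]
      funext a
      simp [siso, Matrix.mulVec, dotProduct]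

theorem relDegree_eq_relDegree {n' : ℕ} {S : StateSpace n 1 1} {S' : StateSpace n' 1 1}
    (h : S.behavior = S'.behavior) : S.relDegree = S'.relDegree := by
  simp only [relDegree, S.impulseResponse_eq h]

theorem relDegree_behavior (S : StateSpace n 1 1) : LTI.relDegree S.behavior = S.relDegree := by
  refine le_antisymm (iInf_le_of_le n (iInf_le_of_le S (iInf_le _ rfl))) ?_
  refine le_iInf fun n' => le_iInf fun S' => le_iInf fun h => ?_
  rw [relDegree_eq_relDegree h]

theorem outputRelDegree_behavior (i : Fin p) :
    outputRelDegree S.behavior i = ⨅ (k : ℕ) (_ : S.impulseResponse k i ≠ 0), (k : ℕ∞) := by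
  have h1 : ∀ j k, (S.siso i j).impulseResponse k ≠ 0 ↔ S.impulseResponse k i j ≠ 0 := by
    intro j k
    refine not_congr ⟨fun h => ?_, fun h => ?_⟩
    · rw [← S.impulseResponse_siso i j k 0 0, h]; rfl
    · ext a b; rw [impulseResponse_siso, h]; rfl
  simp only [outputRelDegree, ← behavior_siso, relDegree_behavior, relDegree, h1]
  refine le_antisymm (le_iInf fun k => le_iInf fun hk => ?_)
    (le_iInf fun j => le_iInf fun k => le_iInf fun hk => ?_)
  · obtain ⟨j, hj⟩ := Function.ne_iff.1 hk
    exact iInf_le_of_le j (iInf_le_of_le k (iInf_le _ hj))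
  · exact iInf_le_of_le k (iInf_le _ (fun h => hk (congrFun h j)))

theorem impulseResponse_eq_zero_of_lt {i : Fin p} {k : ℕ}
    (h : (k : ℕ∞) < outputRelDegree S.behavior i) : S.impulseResponse k i = 0 := by
  by_contra hk
  rw [outputRelDegree_behavior] at h
  exact absurd (iInf_le_of_le k (iInf_le _ hk)) (not_le.2 h)

/-- A finite relative degree is at most the state dimension. -/
theorem toNat_outputRelDegree_le {i : Fin p} (h : outputRelDegree S.behavior i ≠ ⊤) :
    (outputRelDegree S.behavior i).toNat ≤ n := by
  by_contra hlt
  rw [not_le] at hlt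
  have hlt' : (n : ℕ∞) < outputRelDegree S.behavior i := by
    rw [← ENat.natCast_toNat h]; exact_mod_cast hlt
  have h0 : ∀ k, k ≤ n → S.impulseResponse k i = 0 := fun k hk =>
    S.impulseResponse_eq_zero_of_lt (lt_of_le_of_lt (by exact_mod_cast hk) hlt')
  let φ : Matrix (Fin n) (Fin n) ℝ →ₗ[ℝ] (Fin m → ℝ) :=
    { toFun := fun M => (S.C * M * S.B) i
      map_add' := fun M N => by rw [Matrix.mul_add, Matrix.add_mul]; rfl
      map_smul' := fun c M => by simp; rfl }
  have h1 : ∀ k, S.impulseResponse k i = 0 := by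
    intro k
    cases k with
    | zero => exact h0 0 (by omega)
    | succ k => exact map_pow_eq_zero S.A φ (fun k hk => h0 (k + 1) (by omega)) k
  apply h
  rw [outputRelDegree_behavior]
  simp [h1]

end StateSpace

/-! ### Minimal representations -/

section Minimal

variable {m p : ℕ} {B : Set (ℕ → Signal m p)}

theorem exists_minimal_representation (hB : IsSystem B) :
    ∃ S : StateSpace (mcMillanDegree B) m p, S.behavior = B := by
  obtain ⟨V, hV⟩ := hB.linear
  exact Nat.sInf_mem (s := {n : ℕ | ∃ S : StateSpace n m p, S.behavior = B})
    ⟨_, exists_representation hB hV⟩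

/-- Minimal representations are observable. -/
theorem observable_of_minimal (hB : IsSystem B) (S : StateSpace (mcMillanDegree B) m p)
    (hS : S.behavior = B) {x : Fin (mcMillanDegree B) → ℝ}
    (hx : ∀ k, (S.C * S.A ^ k).mulVec x = 0) : x = 0 := by
  obtain ⟨V, hV⟩ := hB.linear
  have := finiteDimensional_zeroInputSpace hB hV
  have hle : mcMillanDegree B ≤ Module.finrank ℝ (zeroInputSpace V) :=
    Nat.sInf_le (exists_representation hB hV)
  let O : (Fin (mcMillanDegree B) → ℝ) →ₗ[ℝ] (ℕ → Fin p → ℝ) :=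
    LinearMap.pi fun k => (S.C * S.A ^ k).mulVecLin
  -- The range contains a space of dimension at least that of the domain, so `O` is injective.
  have hO : zeroInputSpace V ≤ O.range := by
    intro y hy
    have h1 : (fun t => ((0, y t) : Signal m p)) ∈ S.behavior := by
      rw [hS, ← hV]; exact hy
    obtain ⟨x, hx⟩ := h1
    refine ⟨x 0, funext fun k => ?_⟩
    have := S.output_after_impulse hx (t₀ := 0) k (fun _ _ _ => rfl)
    simpa [O] using this.symm
  have h2 := Submodule.finrank_mono hO
  have h3 := O.finrank_range_add_finrank_ker
  rw [Module.finrank_fin_fun] at h3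
  have h4 : O.ker = ⊥ := Submodule.finrank_eq_zero.1 (by omega)
  have h5 : x ∈ O.ker := by
    rw [LinearMap.mem_ker]
    exact funext hx
  rw [h4] at h5
  exact h5

/-- A minimal representation whose states are determined by zero-input outputs on `[0, l)`. -/
theorem exists_representation_lag (hB : IsSystem B) :
    ∃ S : StateSpace (mcMillanDegree B) m p, S.behavior = B ∧
      ∀ x, (∀ k < lag B, (S.C * S.A ^ k).mulVec x = 0) → x = 0 := by
  obtain ⟨S, hS⟩ := exists_minimal_representation hB
  obtain ⟨S', hS', hr⟩ := Nat.sInf_mem (s := {K : ℕ | ∃ S : StateSpace (mcMillanDegree B) m p,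
    S.behavior = B ∧ (S.observabilityMatrix K).rank = mcMillanDegree B}) ⟨mcMillanDegree B, S, hS, by
      have := rank_eq_card_of_mulVec_eq_zero (M := S.observabilityMatrix (mcMillanDegree B))
        (fun v hv => observable_of_minimal hB S hS (S.unobservable_of_lt fun k hk =>
          funext fun i => congrFun hv (⟨k, hk⟩, i)))
      rwa [Fintype.card_fin] at this⟩
  refine ⟨S', hS', fun x hx => mulVec_eq_zero_of_rank_eq_card (hr.trans (Fintype.card_fin _).symm) ?_⟩
  funext ⟨k, i⟩
  exact congrFun (hx k k.isLt) i

/-- Observable representations of controllable behaviors are controllable. -/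
theorem reachable_of_controllable (hctrl : Controllable B) {n : ℕ} (S : StateSpace n m p)
    (hS : S.behavior = B) (hobs : ∀ x, (∀ k, (S.C * S.A ^ k).mulVec x = 0) → x = 0)
    {ξ : Fin n → ℝ} (hξ : ∀ k < n, Matrix.vecMul ξ (S.A ^ k * S.B) = 0) : ξ = 0 := by
  let φ : Matrix (Fin n) (Fin n) ℝ →ₗ[ℝ] (Fin m → ℝ) :=
    { toFun := fun M => Matrix.vecMul ξ (M * S.B)
      map_add' := fun M N => by rw [Matrix.add_mul, Matrix.vecMul_add]
      map_smul' := fun c M => by simp [Matrix.vecMul_smul] }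
  have hξ' : ∀ k, Matrix.vecMul ξ (S.A ^ k * S.B) = 0 := map_pow_eq_zero S.A φ hξ
  obtain ⟨z, w, hz0, hwu, hw, hz⟩ := S.exists_trajectory ξ 0
  obtain ⟨z0, w0, hz00, hwu0, hw0, hzz⟩ := S.exists_trajectory 0 0
  have hw00 : ∀ k, (w0 k).2 = 0 := fun k => by
    have := S.output_after_impulse hzz (t₀ := 0) k (fun t _ _ => hwu0 t)
    rw [hwu0, hz00] at this
    simpa using this
  -- The zero trajectory is joined to the free motion from `ξ`. By observability the joining state
  -- runs from `0` to `ξ`; it stays orthogonal to `ξ` because `ξ` annihilates all `A ^ k B`.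
  obtain ⟨T', hT', v, hv, hp, hf⟩ := hctrl (n + 1) (by omega) w0 (hS ▸ hw0) w (hS ▸ hw)
  rw [← hS] at hv
  obtain ⟨x, hx⟩ := hv
  have hx0 : x 0 = 0 := by
    refine hobs _ (S.unobservable_of_lt fun k hk => ?_)
    have := S.output_after_impulse hx (t₀ := 0) k (fun t _ ht => by
      rw [hp t (by omega), hwu0]; rfl)
    rw [zero_add, hp k (by omega), hp 0 (by omega), hw00, hwu0] at this
    simpa using this.symm
  have hxT : x (n + 1 + T') = ξ := by
    refine sub_eq_zero.1 (hobs _ fun k => ?_)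
    have h1 := S.output_after_impulse hx (t₀ := n + 1 + T') k (fun t ht _ => by
      rw [hf t (by omega), hwu]; rfl)
    have h2 := S.output_after_impulse hz (t₀ := 0) k (fun t ht _ => hwu t)
    rw [hf _ (by omega), hf _ le_rfl, show n + 1 + T' + k - (n + 1) - T' = 0 + k by omega, h2,
      show n + 1 + T' - (n + 1) - T' = 0 by omega, hz0] at h1
    rw [Matrix.mulVec_sub, sub_eq_zero]
    exact (add_right_cancel h1).symm
  have hinv : ∀ t k, dotProduct ξ ((S.A ^ k).mulVec (x t)) = 0 := by
    intro t
    induction t with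
    | zero => intro k; simp [hx0]
    | succ t ih =>
      intro k
      rw [(hx t).1, Matrix.mulVec_add, dotProduct_add, Matrix.mulVec_mulVec, ← pow_succ, ih,
        Matrix.mulVec_mulVec, Matrix.dotProduct_mulVec, hξ' k]
      simp
  have := hinv (n + 1 + T') 0
  rw [pow_zero, Matrix.one_mulVec, hxT] at this
  exact dotProduct_self_eq_zero.1 this

end Minimal

/-! ### Persistently exciting inputs -/

namespace StateSpace

variable {n m p : ℕ} (S : StateSpace n m p)

theorem state_add {x : ℕ → Fin n → ℝ} {u : ℕ → Fin m → ℝ}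
    (hx : ∀ t, x (t + 1) = S.A.mulVec (x t) + S.B.mulVec (u t)) (s k : ℕ) :
    x (s + k) = (S.A ^ k).mulVec (x s) +
      ∑ i ∈ Finset.range k, (S.A ^ (k - 1 - i) * S.B).mulVec (u (s + i)) := by
  induction k with
  | zero => simp
  | succ k ih =>
    rw [← add_assoc, hx, ih, Finset.sum_range_succ, Matrix.mulVec_add, Matrix.mulVec_mulVec,
      ← pow_succ', Matrix.mulVec_sum, show k + 1 - 1 - k = 0 by omega, pow_zero, Matrix.one_mul,
      ← add_assoc]
    congr 2
    refine Finset.sum_congr rfl fun i hi => ?_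
    have := Finset.mem_range.1 hi
    rw [Matrix.mulVec_mulVec, ← Matrix.mul_assoc, ← pow_succ',
      show k - 1 - i + 1 = k + 1 - 1 - i by omega]

/-- Coefficient rows of the functional `ξ x(s) + ∑ η_i u(s + i)`, moved forward in time, in
reversed order. -/
def rowSeq (L : ℕ) (ξ : Fin n → ℝ) (η : ℕ → Fin m → ℝ) (j : ℕ) : Fin m → ℝ :=
  if j < L then η (L - 1 - j) else Matrix.vecMul ξ (S.A ^ (j - L) * S.B)

/-- The sequence `rowSeq` does not depend on `k`: delaying the relation only shifts its index. This
makes the relations for different `k` combinable into a triangular system. -/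
theorem dotProduct_state_add {x : ℕ → Fin n → ℝ} {u : ℕ → Fin m → ℝ}
    (hx : ∀ t, x (t + 1) = S.A.mulVec (x t) + S.B.mulVec (u t)) (L : ℕ) (ξ : Fin n → ℝ)
    (η : ℕ → Fin m → ℝ) (s k : ℕ) :
    ξ ⬝ᵥ x (s + k) + ∑ i ∈ Finset.range L, η i ⬝ᵥ u (s + k + i) =
      ξ ⬝ᵥ (S.A ^ k).mulVec (x s) +
        ∑ i ∈ Finset.range (k + L), S.rowSeq L ξ η (k + L - 1 - i) ⬝ᵥ u (s + i) := by
  rw [Finset.sum_range_add, S.state_add hx, dotProduct_add, add_assoc, dotProduct_sum]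
  congr 2
  · refine Finset.sum_congr rfl fun i hi => ?_
    have := Finset.mem_range.1 hi
    rw [Matrix.dotProduct_mulVec, rowSeq, if_neg (by omega),
      show k + L - 1 - i - L = k - 1 - i by omega]
  · refine Finset.sum_congr rfl fun i hi => ?_
    have := Finset.mem_range.1 hi
    rw [rowSeq, if_pos (by omega), show L - 1 - (k + L - 1 - (k + i)) = i by omega, add_assoc]

/-- If the input is persistently exciting of order `L + n` and the representation is reachable, no
nontrivial linear relation holds between the state and the next `L` inputs. -/
theorem eq_zero_of_relation {x : ℕ → Fin n → ℝ} {u : ℕ → Fin m → ℝ}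
    (hx : ∀ t, x (t + 1) = S.A.mulVec (x t) + S.B.mulVec (u t)) {L T : ℕ}
    (hreach : ∀ ξ, (∀ k < n, Matrix.vecMul ξ (S.A ^ k * S.B) = 0) → ξ = 0)
    (hpe : ∀ ζ : ℕ → Fin m → ℝ, (∀ s, s + (L + n) ≤ T + 1 →
      ∑ i ∈ Finset.range (L + n), ζ i ⬝ᵥ u (s + i) = 0) → ∀ i < L + n, ζ i = 0)
    {ξ : Fin n → ℝ} {η : ℕ → Fin m → ℝ}
    (h : ∀ s, s + L ≤ T + 1 → ξ ⬝ᵥ x s + ∑ i ∈ Finset.range L, η i ⬝ᵥ u (s + i) = 0) :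
    ξ = 0 ∧ ∀ i < L, η i = 0 := by
  set G := S.rowSeq L ξ η with hG
  let α : ℕ → ℝ := fun k => S.A.charpoly.coeff k
  have hdeg : S.A.charpoly.natDegree = n := by
    rw [Matrix.charpoly_natDegree_eq_dim, Fintype.card_fin]
  have hαn : α n = 1 := by
    have := S.A.charpoly_monic
    rwa [Polynomial.Monic, Polynomial.leadingCoeff, hdeg] at this
  have hα : ∑ k ∈ Finset.range (n + 1), α k • S.A ^ k = 0 := by
    have := S.A.aeval_self_charpoly
    rwa [Polynomial.aeval_eq_sum_range, hdeg] at this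
  -- Weighting the delayed relations by the coefficients of the characteristic polynomial cancels
  -- the state and leaves a relation among `L + n` inputs alone.
  have hζ := hpe (fun i => ∑ k ∈ Finset.range (n + 1),
      α k • if i < k + L then G (k + L - 1 - i) else 0) (by
    intro s hs
    have h1 : ∀ k ∈ Finset.range (n + 1), ∑ i ∈ Finset.range (L + n),
        (if i < k + L then G (k + L - 1 - i) else 0) ⬝ᵥ u (s + i) =
        - (ξ ⬝ᵥ (S.A ^ k).mulVec (x s)) := by
      intro k hk
      have hk := Finset.mem_range.1 hk
      have h2 := h (s + k) (by omega)
      rw [S.dotProduct_state_add hx L ξ η s k] at h2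
      rw [eq_neg_iff_add_eq_zero, add_comm, ← h2]
      congr 1
      refine (Finset.sum_subset_zero_on_sdiff (Finset.range_mono (by omega)) ?_ ?_).symm
      · intro i hi
        have hi := (Finset.mem_sdiff.1 hi).2
        rw [if_neg (fun h => hi (Finset.mem_range.2 h)), zero_dotProduct]
      · intro i hi
        rw [if_pos (Finset.mem_range.1 hi)]
    calc _ = ∑ k ∈ Finset.range (n + 1), α k * ∑ i ∈ Finset.range (L + n),
          (if i < k + L then G (k + L - 1 - i) else 0) ⬝ᵥ u (s + i) := by
          simp only [sum_dotProduct, smul_dotProduct, Finset.mul_sum, smul_eq_mul]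
          exact Finset.sum_comm
      _ = - (ξ ⬝ᵥ (∑ k ∈ Finset.range (n + 1), α k • S.A ^ k).mulVec (x s)) := by
          rw [Matrix.sum_mulVec, dotProduct_sum, ← Finset.sum_neg_distrib]
          refine Finset.sum_congr rfl fun k hk => ?_
          rw [h1 k hk, Matrix.smul_mulVec, dotProduct_smul, smul_eq_mul, mul_neg]
      _ = 0 := by simp [hα])
  -- The coefficient at `L + n - 1 - j` is `G j`, from the leading coefficient `1`, plus multiples
  -- of `G` at smaller indices.
  have hG0 : ∀ j < L + n, G j = 0 := by
    intro j
    induction j using Nat.strong_induction_on with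
    | _ j ih =>
      intro hj
      have h1 := hζ (L + n - 1 - j) (by omega)
      beta_reduce at h1
      rw [Finset.sum_range_succ, Finset.sum_eq_zero, zero_add, hαn, one_smul, if_pos (by omega),
        show n + L - 1 - (L + n - 1 - j) = j by omega] at h1
      · exact h1
      · intro k hk
        have hk := Finset.mem_range.1 hk
        split_ifs with hi
        · rw [ih _ (by omega) (by omega), smul_zero]
        · rw [smul_zero]
  refine ⟨hreach ξ fun k hk => ?_, fun i hi => ?_⟩
  · have := hG0 (L + k) (by omega)
    rwa [hG, rowSeq, if_neg (by omega), Nat.add_sub_cancel_left] at this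
  · have := hG0 (L - 1 - i) (by omega)
    rwa [hG, rowSeq, if_pos (by omega), show L - 1 - (L - 1 - i) = i by omega] at this

end StateSpace

theorem eq_zero_of_persistentlyExciting {q T K : ℕ} {u : Fin (T + 1) → Fin q → ℝ}
    (hpe : PersistentlyExciting K u) {v : ℕ → Fin q → ℝ} (hv : ∀ t : Fin (T + 1), v t = u t)
    (ζ : ℕ → Fin q → ℝ)
    (hζ : ∀ s, s + K ≤ T + 1 → ∑ i ∈ Finset.range K, ζ i ⬝ᵥ v (s + i) = 0) :
    ∀ i < K, ζ i = 0 := by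
  have hK := hpe.1
  have hinj := vecMul_injective_of_rank_eq_card (M := hankel K u) (by simpa using hpe.2)
  have h0 : (fun kc : Fin K × Fin q => ζ kc.1 kc.2) = 0 := by
    refine hinj ?_
    beta_reduce
    rw [Matrix.zero_vecMul]
    funext s
    rw [Pi.zero_apply, ← hζ s (by have := s.isLt; omega), Finset.sum_range]
    simp only [Matrix.vecMul, dotProduct, Fintype.sum_prod_type, hankel, Matrix.of_apply, ← hv,
      add_comm]
  intro i hi
  funext c
  exact congrFun h0 (⟨i, hi⟩, c)

/-- Persistency of excitation of order `L + n`: every initial state together with every input of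
length `L` is a linear combination of windows of the data. -/
theorem exists_combination {n m p T L : ℕ} (S : StateSpace n m p)
    (hreach : ∀ ξ, (∀ k < n, Matrix.vecMul ξ (S.A ^ k * S.B) = 0) → ξ = 0)
    {u : Fin (T + 1) → Fin m → ℝ} (hpe : PersistentlyExciting (L + n) u)
    {x : ℕ → Fin n → ℝ} {v : ℕ → Fin m → ℝ} (hv : ∀ t : Fin (T + 1), v t = u t)
    (hx : ∀ t, x (t + 1) = S.A.mulVec (x t) + S.B.mulVec (v t))
    (x₀ : Fin n → ℝ) (f : Fin L × Fin m → ℝ) :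
    ∃ g : Fin (T + 2 - L) → ℝ, ∑ s, g s • x s = x₀ ∧ (hankel L u).mulVec g = f := by
  have hL := hpe.1
  -- States stacked on input windows: a left kernel vector is a relation excluded by
  -- `eq_zero_of_relation`, so the columns span.
  let M : Matrix (Fin n ⊕ Fin L × Fin m) (Fin (T + 2 - L)) ℝ :=
    Matrix.of (Sum.elim (fun a s => x s a) (hankel L u))
  have hMl : ∀ a s, M (Sum.inl a) s = x s a := fun _ _ => rfl
  have hMr : ∀ k b (s : Fin (T + 2 - L)), M (Sum.inr (k, b)) s = v (s + k) b := fun k b s => by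
    rw [add_comm]
    exact congrFun (hv ⟨k + s, by omega⟩).symm b
  have hM : ∀ c, Matrix.vecMul c M = 0 → c = 0 := by
    intro c hc
    let η : ℕ → Fin m → ℝ := fun i b => if h : i < L then c (Sum.inr (⟨i, h⟩, b)) else 0
    obtain ⟨h1, h2⟩ := S.eq_zero_of_relation hx (L := L) (T := T) hreach
      (eq_zero_of_persistentlyExciting hpe hv) (ξ := fun a => c (Sum.inl a)) (η := η) (by
        intro s hs
        have := congrFun hc ⟨s, by omega⟩
        simp only [Matrix.vecMul, dotProduct, Fintype.sum_sum_type, hMl, hMr,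
          Fintype.sum_prod_type, Pi.zero_apply] at this
        rw [← this, Finset.sum_range]
        simp [dotProduct, η])
    funext a
    rcases a with a | ⟨k, b⟩
    · exact congrFun h1 a
    · have := congrFun (h2 k k.isLt) b
      simpa [η] using this
  obtain ⟨g, hg⟩ := mulVec_surjective_of_vecMul_eq_zero hM (Sum.elim x₀ f)
  refine ⟨g, funext fun a => ?_, funext fun k => ?_⟩
  · rw [Finset.sum_apply]
    refine Eq.trans ?_ (congrFun hg (Sum.inl a))
    simp [Matrix.mulVec, dotProduct, hMl, mul_comm]
  · exact congrFun hg (Sum.inr k)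

/-! ### The data-based impulse response -/

theorem hankel_mulVec {q T L : ℕ} {u : Fin (T + 1) → Fin q → ℝ} {v : ℕ → Fin q → ℝ}
    (hv : ∀ t : Fin (T + 1), v t = u t) (g : Fin (T + 2 - L) → ℝ) (k : Fin L) (c : Fin q) :
    (hankel L u).mulVec g (k, c) = (∑ s, g s • v (k + s)) c := by
  simp [Matrix.mulVec, dotProduct, hankel, ← hv, mul_comm]

/-- Superposing shifted copies of one trajectory, with its states, gives a trajectory again; thus
Hankel products `H g` obey the state equations. -/
theorem combination_trajectory {n m p N : ℕ} (S : StateSpace n m p) {x : ℕ → Fin n → ℝ}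
    {w : ℕ → Signal m p} (hx : ∀ t, x (t + 1) = S.A.mulVec (x t) + S.B.mulVec (w t).1 ∧
      (w t).2 = S.C.mulVec (x t) + S.D.mulVec (w t).1) (g : Fin N → ℝ) (t : ℕ) :
    ∑ s, g s • x (t + 1 + s) =
      S.A.mulVec (∑ s, g s • x (t + s)) + S.B.mulVec (∑ s, g s • (w (t + s)).1) ∧
    ∑ s, g s • (w (t + s)).2 =
      S.C.mulVec (∑ s, g s • x (t + s)) + S.D.mulVec (∑ s, g s • (w (t + s)).1) := by
  simp only [Matrix.mulVec_sum, Matrix.mulVec_smul, ← Finset.sum_add_distrib, ← smul_add]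
  refine ⟨Finset.sum_congr rfl fun s _ => ?_, Finset.sum_congr rfl fun s _ => ?_⟩
  · rw [add_right_comm, (hx _).1]
  · rw [(hx _).2]

/-- For observable representations, `z^(j)` can only be the `j`-th column of the impulse response. -/
theorem IsDataImpulseOutput.eq_impulseResponse {n m p T L l : ℕ} (S : StateSpace n m p)
    (hobs : ∀ x, (∀ k < l, (S.C * S.A ^ k).mulVec x = 0) → x = 0) (hl : l < L)
    {u : Fin (T + 1) → Fin m → ℝ} {y : Fin (T + 1) → Fin p → ℝ}
    (hdata : IsSampledFrom S.behavior u y) {j : Fin m} {z : Fin (L - l) → Fin p → ℝ}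
    (hz : IsDataImpulseOutput u y L l j z) (k : Fin (L - l)) (i : Fin p) :
    z k i = S.impulseResponse k i j := by
  obtain ⟨w, ⟨x, hx⟩, hw⟩ := hdata
  obtain ⟨g, h1, h2, h3⟩ := hz
  have hc := combination_trajectory S hx g
  set x' : ℕ → Fin n → ℝ := fun t => ∑ s, g s • x (t + s)
  set w' : ℕ → Signal m p := fun t => (∑ s, g s • (w (t + s)).1, ∑ s, g s • (w (t + s)).2)
  have hx' : ∀ t, x' (t + 1) = S.A.mulVec (x' t) + S.B.mulVec (w' t).1 ∧
      (w' t).2 = S.C.mulVec (x' t) + S.D.mulVec (w' t).1 := hc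
  have hu : ∀ t < L, ∀ c, (w' t).1 c = if t = l ∧ c = j then 1 else 0 := fun t ht c => by
    rw [← h1 ⟨t, ht⟩ c, hankel_mulVec (v := fun t => (w t).1) (fun t => by rw [hw])]
  have hy : ∀ t (ht : t < L) i, (w' t).2 i = (hankel L y).mulVec g (⟨t, ht⟩, i) := fun t ht i => by
    rw [hankel_mulVec (v := fun t => (w t).2) (fun t => by rw [hw])]
  have hu0 : ∀ t < L, t ≠ l → (w' t).1 = 0 := fun t ht htl => by
    funext c; rw [hu t ht, if_neg (fun h => htl h.1)]; rfl
  have hx0 : x' 0 = 0 := by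
    refine hobs _ fun k hk => ?_
    have := S.output_after_impulse hx' (t₀ := 0) k
      (fun t _ ht => hu0 t (by omega) (by omega))
    rw [zero_add, hu0 0 (by omega) (by omega), Matrix.mulVec_zero, add_zero] at this
    rw [← this]
    funext i
    rw [hy k (by omega), h2 _ _ hk]; rfl
  have hxl : x' l = 0 := by
    have := S.state_of_zero_input (u := fun t => (w' t).1) (fun t => (hx' t).1) (t₀ := 0) l
      (fun t _ ht => hu0 t (by omega) (by omega))
    rwa [zero_add, hx0, Matrix.mulVec_zero] at this
  have hul : (w' l).1 = Pi.single j 1 := by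
    funext c
    rw [hu l hl]
    simp [Pi.single_apply]
  have := S.output_after_impulse hx' (t₀ := l) k
    (fun t ht ht' => hu0 t (by omega) (by omega))
  rw [hxl, hul, Matrix.mulVec_zero, zero_add, Matrix.mulVec_single_one] at this
  rw [← h3 k i, ← hy, this]
  rfl

theorem isDataImpulseOutput_impulseResponse {n m p T L l : ℕ} (S : StateSpace n m p)
    (hreach : ∀ ξ, (∀ k < n, Matrix.vecMul ξ (S.A ^ k * S.B) = 0) → ξ = 0) (hl : l < L)
    {u : Fin (T + 1) → Fin m → ℝ} {y : Fin (T + 1) → Fin p → ℝ}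
    (hdata : IsSampledFrom S.behavior u y) (hpe : PersistentlyExciting (L + n) u) (j : Fin m) :
    IsDataImpulseOutput u y L l j (fun k i => S.impulseResponse k i j) := by
  obtain ⟨w, ⟨x, hx⟩, hw⟩ := hdata
  obtain ⟨g, hg0, hg⟩ := exists_combination S hreach hpe (v := fun t => (w t).1)
    (fun t => by rw [hw]) (fun t => (hx t).1) 0
    (fun kc => if (kc.1 : ℕ) = l ∧ kc.2 = j then 1 else 0)
  have hc := combination_trajectory S hx g
  set x' : ℕ → Fin n → ℝ := fun t => ∑ s, g s • x (t + s)
  set w' : ℕ → Signal m p := fun t => (∑ s, g s • (w (t + s)).1, ∑ s, g s • (w (t + s)).2)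
  have hx' : ∀ t, x' (t + 1) = S.A.mulVec (x' t) + S.B.mulVec (w' t).1 ∧
      (w' t).2 = S.C.mulVec (x' t) + S.D.mulVec (w' t).1 := hc
  have hu : ∀ t < L, ∀ c, (w' t).1 c = if t = l ∧ c = j then 1 else 0 := fun t ht c => by
    refine Eq.trans ?_ (congrFun hg (⟨t, ht⟩, c))
    rw [hankel_mulVec (v := fun t => (w t).1) (fun t => by rw [hw])]
  have hy : ∀ t (ht : t < L) i, (hankel L y).mulVec g (⟨t, ht⟩, i) = (w' t).2 i := fun t ht i => by
    rw [hankel_mulVec (v := fun t => (w t).2) (fun t => by rw [hw])]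
  have hu0 : ∀ t < L, t ≠ l → (w' t).1 = 0 := fun t ht htl => by
    funext c; rw [hu t ht, if_neg (fun h => htl h.1)]; rfl
  have hul : (w' l).1 = Pi.single j 1 := by
    funext c
    rw [hu l hl]
    simp [Pi.single_apply]
  have hx0 : x' 0 = 0 := by simpa [x'] using hg0
  have hxl : x' l = 0 := by
    have := S.state_of_zero_input (u := fun t => (w' t).1) (fun t => (hx' t).1) (t₀ := 0) l
      (fun t _ ht => hu0 t (by omega) (by omega))
    rwa [zero_add, hx0, Matrix.mulVec_zero] at this
  refine ⟨g, fun k c => congrFun hg (k, c), fun k i hk => ?_, fun k i => ?_⟩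
  · have := S.output_after_impulse hx' (t₀ := 0) k
      (fun t _ ht => hu0 t (by omega) (by omega))
    rw [zero_add, hu0 0 (by omega) (by omega), hx0, Matrix.mulVec_zero, Matrix.mulVec_zero,
      add_zero] at this
    rw [show k = ⟨k, k.isLt⟩ from rfl, hy, this]; rfl
  · have := S.output_after_impulse hx' (t₀ := l) k
      (fun t ht ht' => hu0 t (by omega) (by omega))
    rw [hxl, hul, Matrix.mulVec_zero, zero_add, Matrix.mulVec_single_one] at this
    rw [hy, this]; rfl

/-! ### Decoupling matrices -/

theorem StateSpace.decouplingMatrix_apply {n m p : ℕ} (S : StateSpace n m p) (r : Fin p → ℕ)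
    (i : Fin p) : S.decouplingMatrix r i = S.impulseResponse (r i) i := by
  change (if r i = 0 then S.D i else (S.C * S.A ^ (r i - 1) * S.B) i) = _
  cases r i with
  | zero => rfl
  | succ k => rfl

/-- An output that does not vanish identically responds to an impulse. -/
theorem outputRelDegree_ne_top {n m p : ℕ} (S : StateSpace n m p)
    (hreach : ∀ ξ, (∀ k < n, Matrix.vecMul ξ (S.A ^ k * S.B) = 0) → ξ = 0) {i : Fin p}
    (h : ∃ w ∈ S.behavior, ∃ t, (w t).2 i ≠ 0) : outputRelDegree S.behavior i ≠ ⊤ := by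
  intro htop
  have h0 : ∀ k : ℕ, S.impulseResponse k i = 0 := fun k =>
    S.impulseResponse_eq_zero_of_lt (by rw [htop]; exact ENat.natCast_lt_top k)
  -- The row `C_i` annihilates all `A ^ k B`, so reachability applies with `ξ = C_i`.
  have hC : S.C i = 0 := hreach _ fun k _ => by
    have := h0 (k + 1)
    rw [StateSpace.impulseResponse, Matrix.mul_assoc, Matrix.mul_apply_eq_vecMul] at this
    exact this
  obtain ⟨w, ⟨x, hx⟩, t, ht⟩ := h
  have hD : S.D i = 0 := h0 0
  apply ht
  rw [(hx t).2, Pi.add_apply, Matrix.mulVec, Matrix.mulVec, hC, hD]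
  simp

theorem row_ne_zero_of_rank_eq {p m : ℕ} {M : Matrix (Fin p) (Fin m) ℝ} (h : M.rank = p)
    (i : Fin p) : M i ≠ 0 := by
  intro hi
  have hinj := vecMul_injective_of_rank_eq_card (M := M) (by simpa using h)
  have : (Pi.single i 1 : Fin p → ℝ) = 0 := hinj (by
    beta_reduce
    rw [Matrix.zero_vecMul, Matrix.single_one_vecMul]; exact hi)
  simpa using congrFun this i

end LTI

theorem mainTheorem5 {m p T : ℕ} (B : Set (ℕ → LTI.Signal m p))
    (hB : LTI.IsSystem B) (hctrl : LTI.Controllable B)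
    (u : Fin (T + 1) → Fin m → ℝ) (y : Fin (T + 1) → Fin p → ℝ)
    (hdata : LTI.IsSampledFrom B u y)
    (L : ℕ) (hL : LTI.lag B + LTI.mcMillanDegree B + 1 ≤ L)
    (hpe : LTI.PersistentlyExciting (L + LTI.mcMillanDegree B) u) :
    -- each output vector `z^(j)` exists and is uniquely determined by the data
    (∀ j : Fin m, ∃! z : Fin (L - LTI.lag B) → Fin p → ℝ,
      LTI.IsDataImpulseOutput u y L (LTI.lag B) j z) ∧
    -- `r_i` is finite unless the `i`-th output vanishes identically
    (∀ i : Fin p, (∃ w ∈ B, ∃ t, (w t).2 i ≠ 0) → LTI.outputRelDegree B i ≠ ⊤) ∧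
    -- finite `r_i` lie in the index range `0, …, L - l - 1` of the blocks of `z^(j)`
    (∀ i : Fin p, LTI.outputRelDegree B i ≠ ⊤ →
      (LTI.outputRelDegree B i).toNat < L - LTI.lag B) ∧
    ∀ z : Fin m → Fin (L - LTI.lag B) → Fin p → ℝ,
      (∀ j, LTI.IsDataImpulseOutput u y L (LTI.lag B) j (z j)) →
      -- the rank criterion
      (((∀ i, LTI.outputRelDegree B i ≠ ⊤) ∧
          LTI.HasVectorRelDegree B (fun i => (LTI.outputRelDegree B i).toNat)) ↔
        (LTI.dataMatrix (LTI.outputRelDegree B) z).rank = p) ∧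
      -- the matrix is the decoupling matrix of every representation
      ((∀ i, LTI.outputRelDegree B i ≠ ⊤) →
        ∀ (n : ℕ) (S : LTI.StateSpace n m p), S.behavior = B →
          S.decouplingMatrix (fun i => (LTI.outputRelDegree B i).toNat) =
            LTI.dataMatrix (LTI.outputRelDegree B) z) := by
  obtain ⟨S, hS, hobs⟩ := LTI.exists_representation_lag hB
  have hreach : ∀ ξ, (∀ k < LTI.mcMillanDegree B, Matrix.vecMul ξ (S.A ^ k * S.B) = 0) → ξ = 0 :=
    fun ξ => LTI.reachable_of_controllable hctrl S hS (fun x hx => hobs x fun k _ => hx k)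
  have hfin : ∀ i : Fin p, LTI.outputRelDegree B i ≠ ⊤ →
      (LTI.outputRelDegree B i).toNat < L - LTI.lag B := by
    intro i hi
    -- `r_i ≤ n < L - l`; this is where the bound `l + n + 1 ≤ L` is needed in full.
    have h1 := S.toNat_outputRelDegree_le (i := i) (by rwa [hS])
    rw [hS] at h1
    omega
  have hz : ∀ j z, LTI.IsDataImpulseOutput u y L (LTI.lag B) j z →
      ∀ k i, z k i = S.impulseResponse k i j := fun j z hz =>
    hz.eq_impulseResponse S hobs (by omega) (by rwa [hS])
  refine ⟨fun j => ⟨_, LTI.isDataImpulseOutput_impulseResponse S hreach (l := LTI.lag B) (by omega)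
    (by rwa [hS]) hpe j, fun z h => ?_⟩, fun i hi => ?_, hfin, fun z hzz => ?_⟩
  · funext k i
    exact hz j z h k i
  · have := LTI.outputRelDegree_ne_top S hreach (i := i) (by rwa [hS])
    rwa [hS] at this
  have hdec : (∀ i, LTI.outputRelDegree B i ≠ ⊤) →
      ∀ (n : ℕ) (S : LTI.StateSpace n m p), S.behavior = B →
        S.decouplingMatrix (fun i => (LTI.outputRelDegree B i).toNat) =
          LTI.dataMatrix (LTI.outputRelDegree B) z := by
    intro hne n S' hS'
    ext i j
    rw [S'.decouplingMatrix_apply, S'.impulseResponse_eq (hS'.trans hS.symm)]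
    simp only [LTI.dataMatrix, Matrix.of_apply]
    rw [dif_pos ⟨hne i, hfin i (hne i)⟩, hz j _ (hzz j)]
  refine ⟨⟨?_, fun hr => ?_⟩, hdec⟩
  · rintro ⟨hne, n, S', hS', h⟩
    rw [← hdec hne n S' hS']
    exact h.2
  -- An infinite `r_i` gives a zero row by the default value in `dataMatrix`, which full row rank
  -- forbids.
  · have hne : ∀ i, LTI.outputRelDegree B i ≠ ⊤ := by
      intro i hi
      refine LTI.row_ne_zero_of_rank_eq hr i (funext fun j => ?_)
      simp [LTI.dataMatrix, hi]
    have h0 : ∀ i (k : ℕ), k < (LTI.outputRelDegree B i).toNat → S.impulseResponse k i = 0 := by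
      intro i k hk
      refine S.impulseResponse_eq_zero_of_lt ?_
      rw [hS, ← ENat.natCast_toNat (hne i)]
      exact_mod_cast hk
    -- `C A ^ k B` is the member `k + 1` of the impulse response, so `k + 2 ≤ r_i` says that its
    -- index lies below `r_i`.
    exact ⟨hne, _, S, hS, fun i => ⟨fun k hk => h0 i (k + 1) (Nat.lt_of_succ_le hk), fun hi => h0 i 0 hi⟩,
      by rw [hdec hne _ S hS, hr]⟩
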